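/- Let $d\ge 1$, $k\ge 0$, $i\ge 1$ and $j\ge 0$ be integers, let $f:\mathbb{R}^d\to[0,\infty)$ be a bounded measurable probability density, and let $A\subseteq\mathbb{R}^d$ be an open set with $\mathrm{vol}(\partial A)=0$. For $r>0$ and points $x_1,\dots,x_i\in\mathbb{R}^d$, let $\mathcal{C}_r(x_1,\dots,x_i)$ be the Čech complex: the simplicial complex with vertices $x_1,\dots,x_i$ in which a nonempty set of vertices spans a face if and only if the closed balls of radius $r$ around these vertices have a common point. Let $g_{i,j,A}^{(r)}(x_1,\dots,x_i)$ be the indicator that $\mathcal{C}_r(x_1,\dots,x_i)$ is connected, has $k$th Betti number $\dim_{\mathbb{Q}} H_k(\,\cdot\,;\mathbb{Q})$ equal to $j$, and has its left-most point (the first of $x_1,\dots,x_i$ in the lexicographic order of the coordinates) in $A$. Then there is a constant $\mu_{i,j,A}\in\mathbb{R}$, depending only on $d,k,i,j,f$ and $A$, such that for every sequence $(r_n)$ of positive numbers with $r_n\to 0$ and all i.i.d. random points $X_1,\dots,X_i$ in $\mathbb{R}^d$ with density $f$, $$\lim_{n\to\infty} r_n^{-d(i-1)}\,\mathbb{E}\left[g_{i,j,A}^{(r_n)}(X_1,\dots,X_i)\right]=\mu_{i,j,A}.$$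 -/

import Mathlib

open MeasureTheory ProbabilityTheory Filter Topology

noncomputable section

namespace RandomCech

section Homology

variable {V : Type*} [LinearOrder V]

/-- The `k`-dimensional simplices of a simplicial complex on a linearly ordered vertex set, each
written as the increasing list of its `k + 1` vertices. -/
def Simplex (K : PreAbstractSimplicialComplex V) (k : ℕ) : Type _ :=
  {s : Fin (k + 1) ↪o V // Finset.univ.map s.toEmbedding ∈ K.faces}

/-- The `l`-th facet of a `(k + 1)`-simplex, obtained by omitting its `l`-th vertex. -/
def Simplex.facet {K : PreAbstractSimplicialComplex V} {k : ℕ} (s : Simplex K (k + 1))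
    (l : Fin (k + 2)) : Simplex K k :=
  ⟨(Fin.succAboveOrderEmb l).trans s.1, by
    refine (K.isRelLowerSet_faces s.2).2 ?_ (by simp)
    intro v hv
    simp only [Finset.mem_map, Finset.mem_univ, true_and] at hv ⊢
    obtain ⟨a, rfl⟩ := hv
    exact ⟨l.succAbove a, rfl⟩⟩

/-- The simplicial boundary map `C_{k+1}(K; ℚ) → C_k(K; ℚ)`,
`[v₀, …, v_{k+1}] ↦ ∑ₗ (-1)ˡ [v₀, …, v̂ₗ, …, v_{k+1}]`. -/
def boundary (K : PreAbstractSimplicialComplex V) (k : ℕ) :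
    (Simplex K (k + 1) →₀ ℚ) →ₗ[ℚ] (Simplex K k →₀ ℚ) :=
  Finsupp.linearCombination ℚ fun s : Simplex K (k + 1) =>
    ∑ l : Fin (k + 2), Finsupp.single (s.facet l) ((-1 : ℚ) ^ (l : ℕ))

/-- The `k`-cycles; every `0`-chain is a cycle (the homology is not reduced). -/
def cycles (K : PreAbstractSimplicialComplex V) : (k : ℕ) → Submodule ℚ (Simplex K k →₀ ℚ)
  | 0 => ⊤
  | k + 1 => LinearMap.ker (boundary K k)

/-- The `k`-th Betti number: the dimension of the `k`-th simplicial homology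
`H_k(K; ℚ) = Z_k / B_k`. -/
def betti (K : PreAbstractSimplicialComplex V) (k : ℕ) : ℕ :=
  Module.finrank ℚ
    (cycles K k ⧸ (LinearMap.range (boundary K k)).submoduleOf (cycles K k))

/-- The `1`-skeleton of a simplicial complex, as a graph on the vertex set. -/
def skeletonGraph (K : PreAbstractSimplicialComplex V) : SimpleGraph V where
  Adj a b := a ≠ b ∧ ({a, b} : Finset V) ∈ K.faces
  symm := ⟨fun a b h => ⟨h.1.symm, Finset.pair_comm a b ▸ h.2⟩⟩
  loopless := ⟨fun _ h => h.1 rfl⟩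

end Homology

variable {d i : ℕ}

/-- The Čech complex of the points `x₁, …, x_i` with radius `r`: a nonempty set of
points spans a face iff the closed balls of radius `r` around these points have a common point.
The vertices are recorded by their labels, which is the same as the points themselves when these
are distinct. -/
def cechComplex (r : ℝ) (x : Fin i → EuclideanSpace ℝ (Fin d)) :
    PreAbstractSimplicialComplex (Fin i) where
  faces := {s | s.Nonempty ∧ (⋂ a ∈ s, Metric.closedBall (x a) r).Nonempty}
  isRelLowerSet_faces := by
    rintro s ⟨hs, hr⟩
    refine ⟨hs, fun t hts ht => ⟨ht, hr.mono ?_⟩⟩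
    exact Set.biInter_subset_biInter_left hts

/-- `x a` is the left-most one of the points `x₁, …, x_i`, that is, the first one in the
lexicographic order of the coordinates. -/
def IsLeftMost (x : Fin i → EuclideanSpace ℝ (Fin d)) (a : Fin i) : Prop :=
  ∀ b, toLex (fun l => x a l) ≤ toLex (fun l => x b l)

open Classical in
/-- The indicator that the Čech complex of radius `r` on `x₁, …, x_i` is connected, has `k`-th
Betti number `j`, and has its left-most point in `A`. -/
def g (k j : ℕ) (A : Set (EuclideanSpace ℝ (Fin d))) (r : ℝ)
    (x : Fin i → EuclideanSpace ℝ (Fin d)) : ℝ :=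
  if (skeletonGraph (cechComplex r x)).Connected ∧ betti (cechComplex r x) k = j ∧
      ∃ a, IsLeftMost x a ∧ x a ∈ A then 1 else 0

end RandomCech

end

/-! Put `i = m + 1` and write the expectation as the integral of `g` against `∏ f (x b)`. The
substitution `x 0 = c`, `x b = c + r • y b` has Jacobian `r ^ (d * m)`, which cancels the
normalisation. The Čech complex and the left-most label are invariant under translation and positive
dilation, so they depend on `y` alone, and `r` survives only in the weights `φ b (c + r • y b)`,
where each `φ b` is `f` or `A.indicator f`. For fixed `y`, the integral over `c` tends to that of `∏
φ b c`, because translations are continuous on L¹ (`tendsto_integral_prod_translate`); `f` need not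
be continuous. Connectedness confines `y` to a fixed ball (`dist_le_of_connected_cechComplex`), so
dominated convergence in `y` gives the limit. -/

noncomputable section

namespace RandomCech

/-! ### Continuity of translation in L¹, for products. -/

section Translation

variable {E : Type*} [NormedAddCommGroup E] [InnerProductSpace ℝ E] [FiniteDimensional ℝ E]
  [MeasurableSpace E] [BorelSpace E]

/-- Translations act continuously on `L¹`. -/
theorem tendsto_integral_abs_translate_sub {φ : E → ℝ} (hφ : Integrable φ) {t : ℕ → E}
    (ht : Tendsto t atTop (𝓝 0)) :
    Tendsto (fun n => ∫ x, |φ (x + t n) - φ x|) atTop (𝓝 0) := by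
  have hm : MemLp φ 1 (volume : Measure E) := memLp_one_iff_integrable.2 hφ
  have hc : Continuous fun v : E => DomAddAct.mk v +ᵥ hm.toLp φ := by
    -- Translation acts continuously on `Lp` only for finite exponent.
    have : Fact ((1 : ENNReal) ≠ ⊤) := ⟨ENNReal.one_ne_top⟩
    have h : Continuous fun v : E => (DomAddAct.mk v : Eᵈᵃᵃ) := DomAddAct.continuous_mk
    exact h.vadd continuous_const
  have h1 := (hc.tendsto 0).comp ht
  rw [tendsto_iff_norm_sub_tendsto_zero] at h1
  refine h1.congr fun n => ?_
  simp only [Function.comp]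
  have h0 : DomAddAct.mk (0 : E) +ᵥ hm.toLp φ = hm.toLp φ := by
    have : DomAddAct.mk (0 : E) = 0 := rfl
    rw [this, zero_vadd]
  rw [h0, DomAddAct.mk_vadd_toLp, ← MemLp.toLp_sub, Lp.norm_toLp, eLpNorm_one_eq_lintegral_enorm,
    ← integral_norm_eq_lintegral_enorm]
  · simp [add_comm, Real.norm_eq_abs]
  · exact ((hm.comp_measurePreserving (measurePreserving_vadd (t n) volume)).sub hm).1

/-- Telescoping: one factor is exchanged at a time. The assumption `1 ≤ C` allows the cruder
exponent `s.card`. -/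
theorem abs_prod_sub_prod_le {ι : Type*} (s : Finset ι) (a b : ι → ℝ) {C : ℝ} (hC : 1 ≤ C)
    (ha : ∀ l, |a l| ≤ C) (hb : ∀ l, |b l| ≤ C) :
    |∏ l ∈ s, a l - ∏ l ∈ s, b l| ≤ C ^ s.card * ∑ l ∈ s, |a l - b l| := by
  classical
  induction s using Finset.induction_on with
  | empty => simp
  | insert c s hc ih =>
    rw [Finset.prod_insert hc, Finset.prod_insert hc, Finset.card_insert_of_notMem hc,
      Finset.sum_insert hc]
    have h1 : |∏ l ∈ s, a l| ≤ C ^ s.card := by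
      rw [Finset.abs_prod]
      exact (Finset.prod_le_prod (fun _ _ => abs_nonneg _) fun l _ => ha l).trans_eq
        (Finset.prod_const C)
    have h2 : C ^ s.card ≤ C ^ (s.card + 1) := pow_le_pow_right₀ hC (Nat.le_succ _)
    calc |a c * ∏ l ∈ s, a l - b c * ∏ l ∈ s, b l|
        = |(a c - b c) * ∏ l ∈ s, a l + b c * (∏ l ∈ s, a l - ∏ l ∈ s, b l)| := by ring_nf
      _ ≤ |a c - b c| * |∏ l ∈ s, a l| + |b c| * |∏ l ∈ s, a l - ∏ l ∈ s, b l| := by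
        rw [← abs_mul, ← abs_mul]; exact abs_add_le _ _
      _ ≤ |a c - b c| * C ^ (s.card + 1) + C * (C ^ s.card * ∑ l ∈ s, |a l - b l|) := by
        gcongr
        · exact h1.trans h2
        · exact hb c
      _ = C ^ (s.card + 1) * (|a c - b c| + ∑ l ∈ s, |a l - b l|) := by ring

/-- One factor supplies integrability and the other `m` are bounded, so at least one factor is
needed. -/
theorem integrable_prod_translate {m : ℕ} {φ : Fin (m + 1) → E → ℝ} {C : ℝ}
    (hφ : ∀ b, Integrable (φ b)) (hC : ∀ b x, |φ b x| ≤ C) (t : Fin (m + 1) → E) :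
    Integrable fun x => ∏ b, φ b (x + t b) := by
  have hsh : ∀ b, Integrable fun x => φ b (x + t b) := fun b => (hφ b).comp_add_right (t b)
  simp_rw [Fin.prod_univ_succ]
  refine (hsh 0).mul_bdd (c := C ^ m) ?_ ?_
  · exact Finset.aestronglyMeasurable_fun_prod _ fun b _ => (hsh b.succ).1
  · refine Eventually.of_forall fun x => ?_
    rw [Real.norm_eq_abs, Finset.abs_prod]
    refine (Finset.prod_le_prod (fun _ _ => abs_nonneg _) fun l _ => hC _ _).trans_eq ?_
    simp

/-- The integral of a product of translates of bounded integrable functions converges when the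
translation vectors tend to zero. -/
theorem tendsto_integral_prod_translate {m : ℕ} {φ : Fin (m + 1) → E → ℝ} {C : ℝ}
    (hφ : ∀ b, Integrable (φ b)) (hC : ∀ b x, |φ b x| ≤ C) {r : ℕ → ℝ}
    (hr : Tendsto r atTop (𝓝 0)) (v : Fin (m + 1) → E) :
    Tendsto (fun n => ∫ x, ∏ b, φ b (x + r n • v b)) atTop (𝓝 (∫ x, ∏ b, φ b x)) := by
  set D := max C 1
  have hD : ∀ b x, |φ b x| ≤ D := fun b x => (hC b x).trans (le_max_left _ _)
  have hint := fun t => integrable_prod_translate hφ hC t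
  have hint0 : Integrable fun x => ∏ b, φ b x := by simpa using hint 0
  have ht : ∀ b, Tendsto (fun n => r n • v b) atTop (𝓝 0) := fun b => by
    simpa using hr.smul_const (v b)
  have hd : ∀ b n, Integrable fun x => |φ b (x + r n • v b) - φ b x| := fun b n =>
    (((hφ b).comp_add_right (r n • v b)).sub (hφ b)).abs
  have hlim : Tendsto (fun n => D ^ (m + 1) * ∑ b, ∫ x, |φ b (x + r n • v b) - φ b x|) atTop
      (𝓝 0) := by
    have := (tendsto_finsetSum Finset.univ fun b _ =>
      tendsto_integral_abs_translate_sub (hφ b) (ht b)).const_mul (D ^ (m + 1))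
    simpa using this
  rw [tendsto_iff_norm_sub_tendsto_zero]
  refine squeeze_zero (fun _ => norm_nonneg _) (fun n => ?_) hlim
  rw [← integral_sub (hint fun b => r n • v b) hint0]
  refine (norm_integral_le_integral_norm _).trans ?_
  rw [← integral_finsetSum _ fun b _ => hd b n, ← integral_const_mul]
  refine integral_mono ((hint fun b => r n • v b).sub hint0).norm
    ((integrable_finsetSum _ fun b _ => hd b n).const_mul _) fun x => ?_
  simpa using abs_prod_sub_prod_le Finset.univ (fun b => φ b (x + r n • v b)) (fun b => φ b x)
    (le_max_right _ _) (fun b => hD b _) (fun b => hD b _)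

end Translation

/-! ### Joint density of independent points. -/

section Density

variable {ι E : Type*} [Fintype ι] [MeasureSpace E] [SigmaFinite (volume : Measure E)]

theorem pi_withDensity_ofReal {f : E → ℝ} (hf0 : ∀ x, 0 ≤ f x)
    (hfi : Integrable f) :
    Measure.pi (fun _ : ι => (volume : Measure E).withDensity fun x => ENNReal.ofReal (f x)) =
      (volume : Measure (ι → E)).withDensity fun x => ENNReal.ofReal (∏ a, f (x a)) := by
  have : SigmaFinite ((volume : Measure E).withDensity fun x => ENNReal.ofReal (f x)) :=
    SigmaFinite.withDensity_ofReal f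
  have hprod : Integrable fun x : ι → E => ∏ a, f (x a) := by
    rw [volume_pi]
    exact Integrable.fintype_prod (𝕜 := ℝ) (f := fun _ : ι => f) fun _ => hfi
  refine Measure.pi_eq fun s hs => ?_
  have hs' : MeasurableSet (Set.univ.pi s) := MeasurableSet.univ_pi hs
  -- Over a box the integrand splits into one-variable factors, so its integral is a product.
  have hind : ∀ x : ι → E, (Set.univ.pi s).indicator (fun x => ∏ a, f (x a)) x =
      ∏ a, (s a).indicator f (x a) := by
    intro x
    by_cases hx : x ∈ Set.univ.pi s
    · rw [Set.indicator_of_mem hx]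
      exact Finset.prod_congr rfl fun a _ => (Set.indicator_of_mem (hx a trivial) _).symm
    · rw [Set.indicator_of_notMem hx]
      simp only [Set.mem_univ_pi, not_forall] at hx
      obtain ⟨a, ha⟩ := hx
      exact (Finset.prod_eq_zero (Finset.mem_univ a) (Set.indicator_of_notMem ha _)).symm
  rw [withDensity_apply _ hs', ← ofReal_integral_eq_lintegral_ofReal
    hprod.integrableOn
    (Eventually.of_forall fun x => Finset.prod_nonneg fun a _ => hf0 _), ← integral_indicator hs']
  simp_rw [hind]
  rw [integral_fintype_prod_volume_eq_prod (fun a => (s a).indicator f),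
    ENNReal.ofReal_prod_of_nonneg fun a _ =>
      integral_nonneg fun x => Set.indicator_nonneg (fun x _ => hf0 x) x]
  refine Finset.prod_congr rfl fun a _ => ?_
  rw [withDensity_apply _ (hs a), integral_indicator (hs a), ofReal_integral_eq_lintegral_ofReal
    hfi.integrableOn (Eventually.of_forall hf0)]

end Density

/-! ### Invariance, measurability and diameter of Čech complexes. -/

section Cech

variable {d i : ℕ}

theorem cechComplex_translate_smul {r : ℝ} (hr : 0 < r) (c : EuclideanSpace ℝ (Fin d))
    (y : Fin i → EuclideanSpace ℝ (Fin d)) :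
    cechComplex r (fun a => c + r • y a) = cechComplex 1 y := by
  have key : ∀ s : Finset (Fin i), (⋂ a ∈ s, Metric.closedBall (c + r • y a) r).Nonempty ↔
      (⋂ a ∈ s, Metric.closedBall (y a) 1).Nonempty := by
    intro s
    have hd : ∀ z a, dist (c + r • z) (c + r • y a) ≤ r ↔ dist z (y a) ≤ 1 := by
      intro z a
      rw [dist_add_left, dist_smul₀, Real.norm_of_nonneg hr.le]
      exact mul_le_iff_le_one_right hr
    simp only [Set.Nonempty, Set.mem_iInter, Metric.mem_closedBall]
    constructor
    · rintro ⟨z, hz⟩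
      refine ⟨r⁻¹ • (z - c), fun a ha => (hd _ a).1 ?_⟩
      simpa [smul_smul, hr.ne'] using hz a ha
    · rintro ⟨z, hz⟩
      exact ⟨c + r • z, fun a ha => (hd z a).2 (hz a ha)⟩
  ext s
  simp only [cechComplex, key]

theorem isLeftMost_translate_smul {r : ℝ} (hr : 0 < r) (c : EuclideanSpace ℝ (Fin d))
    (y : Fin i → EuclideanSpace ℝ (Fin d)) (a : Fin i) :
    IsLeftMost (fun a => c + r • y a) a ↔ IsLeftMost y a := by
  refine forall_congr' fun b => ?_
  -- Strict lexicographic order unfolds to equalities and one strict inequality between coordinates,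
  -- each preserved by the map.
  rw [← not_lt, ← not_lt, not_iff_not]
  refine exists_congr fun l => and_congr (forall₂_congr fun l' _ => ?_) ?_
  · change c l' + r * y b l' = c l' + r * y a l' ↔ y b l' = y a l'
    simp [hr.ne']
  · change c l + r * y b l < c l + r * y a l ↔ y b l < y a l
    simp [hr]

theorem exists_isLeftMost (hi : 1 ≤ i) (x : Fin i → EuclideanSpace ℝ (Fin d)) :
    ∃ a, IsLeftMost x a := by
  have : Nonempty (Fin i) := ⟨⟨0, hi⟩⟩
  exact Finite.exists_min fun a => toLex fun l => x a l

theorem IsLeftMost.eq {x : Fin i → EuclideanSpace ℝ (Fin d)} {a b : Fin i}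
    (ha : IsLeftMost x a) (hb : IsLeftMost x b) : x a = x b := by
  have h := toLex.injective (le_antisymm (ha b) (hb a))
  ext l
  exact congrFun h l

/-- Tied labels carry the same point. The universal form turns the condition into a product over
labels. -/
theorem exists_isLeftMost_mem_iff (hi : 1 ≤ i) (x : Fin i → EuclideanSpace ℝ (Fin d))
    (A : Set (EuclideanSpace ℝ (Fin d))) :
    (∃ a, IsLeftMost x a ∧ x a ∈ A) ↔ ∀ a, IsLeftMost x a → x a ∈ A := by
  constructor
  · rintro ⟨a, ha, hA⟩ b hb
    rwa [← ha.eq hb]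
  · intro h
    obtain ⟨a, ha⟩ := exists_isLeftMost hi x
    exact ⟨a, ha, h a ha⟩

theorem measurableSet_isLeftMost (a : Fin i) :
    MeasurableSet {x : Fin i → EuclideanSpace ℝ (Fin d) | IsLeftMost x a} := by
  have hc : ∀ (b : Fin i) (l : Fin d),
      Measurable fun x : Fin i → EuclideanSpace ℝ (Fin d) => x b l := fun b l => by fun_prop
  have : {x : Fin i → EuclideanSpace ℝ (Fin d) | IsLeftMost x a} =
      ⋂ b, (⋃ l, (⋂ l', ⋂ (_ : l' < l), {x | x b l' = x a l'}) ∩ {x | x b l < x a l})ᶜ := by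
    ext x
    simp only [IsLeftMost, Set.mem_ofPred_eq, Set.mem_iInter, Set.mem_compl_iff]
    refine forall_congr' fun b => ?_
    rw [← not_lt, not_iff_not]
    simp only [Set.mem_iUnion, Set.mem_inter_iff, Set.mem_iInter, Set.mem_ofPred_eq]
    rfl
  rw [this]
  refine MeasurableSet.iInter fun b => (MeasurableSet.iUnion fun l => ?_).compl
  exact (MeasurableSet.iInter fun l' => MeasurableSet.iInter fun _ =>
    measurableSet_eq_fun (hc b l') (hc a l')).inter (measurableSet_lt (hc b l) (hc a l))

/-- Compactness: along a convergent sequence of configurations the common points stay bounded, and a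
subsequential limit is a common point for the limit configuration. -/
theorem isClosed_mem_faces_cechComplex (r : ℝ) (s : Finset (Fin i)) :
    IsClosed {x : Fin i → EuclideanSpace ℝ (Fin d) | s ∈ (cechComplex r x).faces} := by
  refine isClosed_of_closure_subset fun x hx => ?_
  obtain ⟨u, hu, hux⟩ := mem_closure_iff_seq_limit.1 hx
  have hs : s.Nonempty := (hu 0).1
  refine ⟨hs, ?_⟩
  obtain ⟨a, ha⟩ := hs
  choose z hz using fun n => (hu n).2
  simp only [Set.mem_iInter, Metric.mem_closedBall] at hz
  have hux' := tendsto_pi_nhds.1 hux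
  obtain ⟨M, hM⟩ := (Metric.isBounded_range_of_tendsto _ (hux' a)).subset_closedBall 0
  have hzM : ∀ n, z n ∈ Metric.closedBall (0 : EuclideanSpace ℝ (Fin d)) (r + M) := fun n => by
    have h1 : dist (u n a) 0 ≤ M := hM ⟨n, rfl⟩
    exact (dist_triangle _ _ _).trans (add_le_add (hz n a ha) h1)
  obtain ⟨w, -, ψ, hψ, hw⟩ := (isCompact_closedBall _ _).tendsto_subseq hzM
  refine ⟨w, ?_⟩
  simp only [Set.mem_iInter, Metric.mem_closedBall]
  intro b hb
  exact le_of_tendsto (hw.dist ((hux' b).comp hψ.tendsto_atTop))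
    (Eventually.of_forall fun n => hz (ψ n) b hb)

/-- Only finitely many complexes exist on `Fin i`, so measurability of each face condition suffices
for any property `H`. -/
theorem measurableSet_cechComplex (r : ℝ) (H : PreAbstractSimplicialComplex (Fin i) → Prop) :
    MeasurableSet {x : Fin i → EuclideanSpace ℝ (Fin d) | H (cechComplex r x)} := by
  have hm : Measurable fun x : Fin i → EuclideanSpace ℝ (Fin d) => (cechComplex r x).faces :=
    measurable_set_iff.2 fun s =>
      measurableSet_setOfPred.1 (isClosed_mem_faces_cechComplex r s).measurableSet
  have hinj : Function.Injective
      (PreAbstractSimplicialComplex.faces : PreAbstractSimplicialComplex (Fin i) → _) := by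
    rintro ⟨_, _⟩ ⟨_, _⟩ h
    cases h
    rfl
  have : {x : Fin i → EuclideanSpace ℝ (Fin d) | H (cechComplex r x)} =
      (fun x => (cechComplex r x).faces) ⁻¹' (PreAbstractSimplicialComplex.faces '' {K | H K}) := by
    ext x
    simp [hinj.mem_set_image, Set.mem_preimage]
  rw [this]
  exact hm (Set.toFinite _).measurableSet

/-- Adjacent vertices lie within `2 * r`, and a path has fewer than `i` edges. -/
theorem dist_le_of_connected_cechComplex {r : ℝ} {x : Fin i → EuclideanSpace ℝ (Fin d)}
    (h : (skeletonGraph (cechComplex r x)).Connected) (hr : 0 ≤ r) (a b : Fin i) :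
    dist (x a) (x b) ≤ 2 * r * i := by
  have hw : ∀ {u v : Fin i} (p : (skeletonGraph (cechComplex r x)).Walk u v),
      dist (x u) (x v) ≤ 2 * r * p.length := by
    intro u v p
    induction p with
    | nil => simp
    | @cons u v w e p ih =>
      obtain ⟨z, hz⟩ := e.2.2
      simp only [Finset.mem_insert, Finset.mem_singleton, Set.mem_iInter,
        Metric.mem_closedBall] at hz
      have h1 := hz u (Or.inl rfl)
      have h2 := hz v (Or.inr rfl)
      have h3 := dist_triangle_left (x u) (x v) z
      have h4 := dist_triangle (x u) (x v) (x w)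
      rw [SimpleGraph.Walk.length_cons]
      push_cast
      linarith
  classical
  obtain ⟨p⟩ := h.preconnected a b
  refine (hw p.toPath.1).trans ?_
  have := p.toPath.2.length_lt
  rw [Fintype.card_fin] at this
  gcongr

end Cech

/-! ### Rescaling around the first point and passage to the limit. -/

section Rescaling

variable {d m : ℕ}

open Classical in
/-- The density `f`, restricted to `A` if `a` is the label of a left-most point of `x`. -/
def leftMostWeight (A : Set (EuclideanSpace ℝ (Fin d))) (f : EuclideanSpace ℝ (Fin d) → ℝ)
    {i : ℕ} (x : Fin i → EuclideanSpace ℝ (Fin d)) (a : Fin i) : EuclideanSpace ℝ (Fin d) → ℝ :=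
  if IsLeftMost x a then A.indicator f else f

/-- The indicator of a property of the Čech complex, times the densities of the points, with the
left-most point restricted to `A`. -/
def weightedIndicator (H : PreAbstractSimplicialComplex (Fin (m + 1)) → Prop)
    (A : Set (EuclideanSpace ℝ (Fin d))) (f : EuclideanSpace ℝ (Fin d) → ℝ) (r : ℝ)
    (x : Fin (m + 1) → EuclideanSpace ℝ (Fin d)) : ℝ :=
  {x | H (cechComplex r x)}.indicator 1 x * ∏ b, leftMostWeight A f x b (x b)

variable {H : PreAbstractSimplicialComplex (Fin (m + 1)) → Prop}
  {A : Set (EuclideanSpace ℝ (Fin d))} {f : EuclideanSpace ℝ (Fin d) → ℝ} {r : ℝ}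

theorem abs_leftMostWeight_le {i : ℕ} (x : Fin i → EuclideanSpace ℝ (Fin d)) (a : Fin i)
    (z : EuclideanSpace ℝ (Fin d)) : |leftMostWeight A f x a z| ≤ |f z| := by
  unfold leftMostWeight
  split_ifs
  · exact norm_indicator_le_norm_self f z
  · exact le_rfl

theorem integrable_leftMostWeight (hA : MeasurableSet A) (hf : Integrable f) {i : ℕ}
    (x : Fin i → EuclideanSpace ℝ (Fin d)) (a : Fin i) :
    Integrable (leftMostWeight A f x a) := by
  unfold leftMostWeight
  split_ifs
  · exact hf.indicator hA
  · exact hf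

theorem measurable_weightedIndicator (hA : MeasurableSet A) (hf : Measurable f) :
    Measurable (weightedIndicator H A f r) := by
  classical
  unfold weightedIndicator
  refine (measurable_one.indicator (measurableSet_cechComplex r H)).mul
    (Finset.measurable_prod _ fun b _ => ?_)
  have : (fun x : Fin (m + 1) → EuclideanSpace ℝ (Fin d) => leftMostWeight A f x b (x b)) =
      {x | IsLeftMost x b}.piecewise (fun x => A.indicator f (x b)) fun x => f (x b) := by
    ext x
    simp only [leftMostWeight, Set.piecewise, Set.mem_ofPred_eq]
    split_ifs <;> rfl
  rw [this]
  exact Measurable.piecewise (measurableSet_isLeftMost b)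
    ((hf.indicator hA).comp (measurable_pi_apply b)) (hf.comp (measurable_pi_apply b))

theorem integrable_weightedIndicator (hA : MeasurableSet A) (hf : Measurable f)
    (hfi : Integrable f) : Integrable (weightedIndicator H A f r) := by
  have hprod : Integrable fun x : Fin (m + 1) → EuclideanSpace ℝ (Fin d) => ∏ a, f (x a) := by
    rw [volume_pi]
    exact Integrable.fintype_prod (𝕜 := ℝ) (f := fun _ => f) fun _ => hfi
  refine hprod.mono (measurable_weightedIndicator hA hf).aestronglyMeasurable
    (Eventually.of_forall fun x => ?_)
  rw [weightedIndicator, norm_mul, Real.norm_eq_abs (∏ _, _), Finset.abs_prod,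
    Real.norm_eq_abs (∏ _, _), Finset.abs_prod]
  refine (mul_le_mul ((norm_indicator_le_norm_self _ _).trans (by simp : _ ≤ (1 : ℝ)))
    (Finset.prod_le_prod (fun _ _ => abs_nonneg _) fun b _ => abs_leftMostWeight_le _ _ _)
    (by positivity) zero_le_one).trans_eq (one_mul _)

/-- The configuration with first point at the origin and the other points at `y`. -/
def originCons (y : Fin m → EuclideanSpace ℝ (Fin d)) : Fin (m + 1) → EuclideanSpace ℝ (Fin d) :=
  Fin.cons 0 y

theorem weightedIndicator_translate_smul (hr : 0 < r) (c : EuclideanSpace ℝ (Fin d))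
    (y : Fin (m + 1) → EuclideanSpace ℝ (Fin d)) :
    weightedIndicator H A f r (fun b => c + r • y b) =
      {y | H (cechComplex 1 y)}.indicator 1 y * ∏ b, leftMostWeight A f y b (c + r • y b) := by
  classical
  simp only [weightedIndicator, leftMostWeight, isLeftMost_translate_smul hr, Set.indicator_apply,
    Set.mem_ofPred_eq, cechComplex_translate_smul hr, Pi.one_apply]

theorem measurable_originCons : Measurable (originCons (d := d) (m := m)) := by
  refine measurable_pi_iff.2 fun b => ?_
  refine Fin.cases ?_ (fun b => ?_) b
  · exact measurable_const
  · exact measurable_pi_apply b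

theorem measurable_weightedIndicator_originCons (hA : MeasurableSet A) (hf : Measurable f) :
    Measurable fun p : EuclideanSpace ℝ (Fin d) × (Fin m → EuclideanSpace ℝ (Fin d)) =>
      weightedIndicator H A f r fun b => p.1 + r • originCons p.2 b := by
  refine (measurable_weightedIndicator hA hf).comp (measurable_pi_iff.2 fun b => ?_)
  have := (measurable_pi_apply b).comp (measurable_originCons (d := d) (m := m))
  exact measurable_fst.add ((this.comp measurable_snd).const_smul r)

/-- A dominating function independent of `r`: label `0` contributes `‖f c‖`, and each other label at
most `C`. -/
theorem norm_weightedIndicator_originCons_le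
    (hH : ∀ K, H K → (skeletonGraph K).Connected) {C : ℝ} (hC : ∀ x, |f x| ≤ C) (hr : 0 < r)
    (c : EuclideanSpace ℝ (Fin d)) (y : Fin m → EuclideanSpace ℝ (Fin d)) :
    ‖weightedIndicator H A f r fun b => c + r • originCons y b‖ ≤
      ‖f c‖ * (Metric.closedBall 0 (2 * (m + 1))).indicator (fun _ => C ^ m) y := by
  classical
  have hC0 : 0 ≤ C := (abs_nonneg _).trans (hC 0)
  rw [weightedIndicator_translate_smul hr]
  by_cases h : H (cechComplex 1 (originCons y))
  · have hy : y ∈ Metric.closedBall 0 (2 * ((m : ℝ) + 1)) := by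
      rw [Metric.mem_closedBall, dist_pi_le_iff (by positivity)]
      intro b
      -- Label `0` sits at the origin, so distances to it are norms.
      have := dist_le_of_connected_cechComplex (hH _ h) zero_le_one b.succ 0
      simpa [originCons] using this
    rw [Set.indicator_of_mem (show originCons y ∈ {y | H (cechComplex 1 y)} from h),
      Set.indicator_of_mem hy, Pi.one_apply, one_mul, Real.norm_eq_abs, Finset.abs_prod,
      Fin.prod_univ_succ]
    refine mul_le_mul ?_ ?_ (by positivity) (by positivity)
    · simpa [originCons] using abs_leftMostWeight_le (A := A) (f := f) (originCons y) 0 c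
    · refine (Finset.prod_le_prod (fun _ _ => abs_nonneg _) fun b _ =>
        (abs_leftMostWeight_le _ _ _).trans (hC _)).trans_eq ?_
      simp
  · rw [Set.indicator_of_notMem (show originCons y ∉ {y | H (cechComplex 1 y)} from h), zero_mul,
      norm_zero]
    exact mul_nonneg (norm_nonneg _) (Set.indicator_nonneg (fun _ _ => by positivity) _)

theorem integrable_indicator_closedBall (R C : ℝ) :
    Integrable ((Metric.closedBall (0 : Fin m → EuclideanSpace ℝ (Fin d)) R).indicator
      fun _ => C) :=
  (integrable_indicator_iff Metric.isClosed_closedBall.measurableSet).2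
    (integrableOn_const measure_closedBall_lt_top.ne)

theorem integrable_weightedIndicator_originCons (hA : MeasurableSet A) (hf : Measurable f)
    (hfi : Integrable f) (hH : ∀ K, H K → (skeletonGraph K).Connected) {C : ℝ}
    (hC : ∀ x, |f x| ≤ C) (hr : 0 < r) :
    Integrable (fun p : EuclideanSpace ℝ (Fin d) × (Fin m → EuclideanSpace ℝ (Fin d)) =>
      weightedIndicator H A f r fun b => p.1 + r • originCons p.2 b) (volume.prod volume) :=
  (hfi.norm.mul_prod (integrable_indicator_closedBall _ _)).mono'
    (measurable_weightedIndicator_originCons hA hf).aestronglyMeasurable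
    (Eventually.of_forall fun p => norm_weightedIndicator_originCons_le hH hC hr p.1 p.2)

/-- Split off the first point `c`; the other `m` points are translated by `c` and scaled by `r` in
dimension `d * m`. -/
theorem integral_weightedIndicator (hA : MeasurableSet A) (hf : Measurable f)
    (hfi : Integrable f) (hH : ∀ K, H K → (skeletonGraph K).Connected) {C : ℝ}
    (hC : ∀ x, |f x| ≤ C) (hr : 0 < r) :
    ∫ x, weightedIndicator H A f r x =
      r ^ (d * m) * ∫ y : Fin m → EuclideanSpace ℝ (Fin d), ∫ c,
        weightedIndicator H A f r fun b => c + r • originCons y b := by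
  let e := MeasurableEquiv.piFinSuccAbove
    (fun _ : Fin (m + 1) => EuclideanSpace ℝ (Fin d)) 0
  have he : MeasurePreserving e.symm (volume.prod volume) volume :=
    (volume_preserving_piFinSuccAbove
      (fun _ : Fin (m + 1) => EuclideanSpace ℝ (Fin d)) 0).symm e
  have hint : Integrable (fun p => weightedIndicator H A f r (e.symm p))
      (volume.prod volume) :=
    (he.integrable_comp_emb e.symm.measurableEmbedding).2 (integrable_weightedIndicator hA hf hfi)
  have hinner : ∀ c : EuclideanSpace ℝ (Fin d),
      ∫ y : Fin m → EuclideanSpace ℝ (Fin d), weightedIndicator H A f r (e.symm (c, y)) =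
        r ^ (d * m) * ∫ y : Fin m → EuclideanSpace ℝ (Fin d),
          weightedIndicator H A f r fun b => c + r • originCons y b := by
    intro c
    set F : (Fin m → EuclideanSpace ℝ (Fin d)) → ℝ :=
      fun y => weightedIndicator H A f r (e.symm (c, y))
    have h1 : ∀ y : Fin m → EuclideanSpace ℝ (Fin d),
        weightedIndicator H A f r (fun b => c + r • originCons y b) =
          F ((fun _ => c) + r • y) := by
      intro y
      simp only [F]
      congr 1
      ext1 b
      refine Fin.cases ?_ (fun b => ?_) b
      · simp [originCons, e]
      · simp [originCons, e]
    simp_rw [h1]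
    rw [Measure.integral_comp_smul volume (fun y => F ((fun _ => c) + y)) r,
      integral_add_left_eq_self F]
    have hd : Module.finrank ℝ (Fin m → EuclideanSpace ℝ (Fin d)) = d * m := by
      simp [Module.finrank_pi_fintype, mul_comm]
    rw [hd, abs_of_pos (by positivity), smul_eq_mul, ← mul_assoc, mul_inv_cancel₀ (by positivity),
      one_mul]
  rw [← he.integral_comp' (g := weightedIndicator H A f r), integral_prod _ hint]
  simp_rw [hinner]
  rw [integral_const_mul, integral_integral_swap
    (integrable_weightedIndicator_originCons hA hf hfi hH hC hr)]

theorem tendsto_integral_weightedIndicator (hA : MeasurableSet A) (hf : Measurable f)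
    (hfi : Integrable f) (hH : ∀ K, H K → (skeletonGraph K).Connected) {C : ℝ}
    (hC : ∀ x, |f x| ≤ C) {r : ℕ → ℝ} (hr : ∀ n, 0 < r n) (hr0 : Tendsto r atTop (𝓝 0)) :
    Tendsto (fun n => (r n ^ (d * m))⁻¹ * ∫ x, weightedIndicator H A f (r n) x) atTop
      (𝓝 (∫ y : Fin m → EuclideanSpace ℝ (Fin d),
        {y | H (cechComplex 1 y)}.indicator 1 (originCons y) *
          ∫ c, ∏ b, leftMostWeight A f (originCons y) b c)) := by
  have h : ∀ n, (r n ^ (d * m))⁻¹ * ∫ x, weightedIndicator H A f (r n) x =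
      ∫ y : Fin m → EuclideanSpace ℝ (Fin d), ∫ c,
        weightedIndicator H A f (r n) fun b => c + r n • originCons y b := fun n => by
    have := hr n
    rw [integral_weightedIndicator hA hf hfi hH hC (hr n), ← mul_assoc,
      inv_mul_cancel₀ (by positivity), one_mul]
  simp_rw [h]
  refine tendsto_integral_of_dominated_convergence
    (fun y => (∫ c, ‖f c‖) *
      (Metric.closedBall 0 (2 * ((m : ℝ) + 1))).indicator (fun _ => C ^ m) y)
    (fun n => ?_) ((integrable_indicator_closedBall _ _).const_mul _)
    (fun n => Eventually.of_forall fun y => ?_) (Eventually.of_forall fun y => ?_)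
  · exact (integrable_weightedIndicator_originCons hA hf hfi hH hC (hr n)).swap.integral_prod_left.1
  · rw [← integral_mul_const]
    exact norm_integral_le_of_norm_le (hfi.norm.mul_const _) (Eventually.of_forall fun c =>
      norm_weightedIndicator_originCons_le hH hC (hr n) c y)
  · simp_rw [weightedIndicator_translate_smul (hr _), integral_const_mul]
    exact (tendsto_integral_prod_translate
      (fun b => integrable_leftMostWeight hA hfi (originCons y) b)
      (fun b x => (abs_leftMostWeight_le _ _ _).trans (hC x)) hr0 (originCons y)).const_mul _

/-- The constraint on `A` is absorbed into the factor of each left-most label. -/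
theorem prod_mul_g (k j : ℕ) (x : Fin (m + 1) → EuclideanSpace ℝ (Fin d)) :
    (∏ a, f (x a)) * g k j A r x =
      weightedIndicator (fun K => (skeletonGraph K).Connected ∧ betti K k = j) A f r x := by
  classical
  unfold g weightedIndicator
  simp only [exists_isLeftMost_mem_iff (Nat.le_add_left 1 m)]
  by_cases hK : (skeletonGraph (cechComplex r x)).Connected ∧ betti (cechComplex r x) k = j
  · rw [Set.indicator_of_mem (by exact hK), Pi.one_apply, one_mul]
    by_cases hx : ∀ a, IsLeftMost x a → x a ∈ A
    · rw [if_pos ⟨hK.1, hK.2, hx⟩, mul_one]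
      refine Finset.prod_congr rfl fun a _ => ?_
      unfold leftMostWeight
      split_ifs with ha
      · exact (Set.indicator_of_mem (hx a ha) f).symm
      · rfl
    · rw [if_neg fun h => hx h.2.2, mul_zero]
      push Not at hx
      obtain ⟨a, ha, haA⟩ := hx
      refine (Finset.prod_eq_zero (Finset.mem_univ a) ?_).symm
      rw [leftMostWeight, if_pos ha, Set.indicator_of_notMem haA]
  · rw [Set.indicator_of_notMem (by exact hK), zero_mul, if_neg fun h => hK ⟨h.1, h.2.1⟩, mul_zero]

theorem measurable_g (k j : ℕ) (hA : MeasurableSet A) :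
    Measurable (g k j A r : (Fin (m + 1) → EuclideanSpace ℝ (Fin d)) → ℝ) := by
  -- With constant weight `1` the weighted indicator is `g` itself.
  have h := measurable_weightedIndicator (f := fun _ => (1 : ℝ)) (r := r) (m := m)
    (H := fun K => (skeletonGraph K).Connected ∧ betti K k = j) hA measurable_const
  have : (g k j A r : (Fin (m + 1) → EuclideanSpace ℝ (Fin d)) → ℝ) =
      weightedIndicator (fun K => (skeletonGraph K).Connected ∧ betti K k = j) A (fun _ => 1) r := by
    ext x
    simpa using prod_mul_g (f := fun _ => 1) (A := A) (r := r) k j x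
  rwa [this]

end Rescaling

end RandomCech

end

/-! ### From the expectation to the rescaled integral. -/

theorem mainTheorem6 (d : ℕ) (hd : 1 ≤ d) (k i j : ℕ) (hi : 1 ≤ i)
    (f : EuclideanSpace ℝ (Fin d) → ℝ) (hf_meas : Measurable f) (hf_nonneg : ∀ x, 0 ≤ f x)
    (hf_bdd : ∃ C : ℝ, ∀ x, f x ≤ C) (hf_int : ∫⁻ x, ENNReal.ofReal (f x) = 1)
    (A : Set (EuclideanSpace ℝ (Fin d))) (hA : IsOpen A) (hA_bdry : volume (frontier A) = 0) :
    ∃ μ : ℝ, ∀ (r : ℕ → ℝ), (∀ n, 0 < r n) → Tendsto r atTop (𝓝 0) →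
      ∀ {Ω : Type*} [MeasurableSpace Ω] (P : Measure Ω) [IsProbabilityMeasure P]
        (X : Fin i → Ω → EuclideanSpace ℝ (Fin d)),
        iIndepFun X P →
        (∀ a, HasLaw (X a) (volume.withDensity fun x => ENNReal.ofReal (f x)) P) →
        (∀ n, Integrable (fun ω => RandomCech.g k j A (r n) fun a => X a ω) P) ∧
        Tendsto (fun n => r n ^ (-((d : ℤ) * ((i : ℤ) - 1))) *
          ∫ ω, RandomCech.g k j A (r n) (fun a => X a ω) ∂P) atTop (𝓝 μ) := by
  obtain ⟨m, rfl⟩ : ∃ m, i = m + 1 := ⟨i - 1, by omega⟩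
  obtain ⟨C, hC⟩ := hf_bdd
  have hfi : Integrable f :=
    ⟨hf_meas.aestronglyMeasurable, (hasFiniteIntegral_iff_ofReal
      (Eventually.of_forall hf_nonneg)).2 (by simp [hf_int])⟩
  have hC' : ∀ x, |f x| ≤ C := fun x => by rw [abs_of_nonneg (hf_nonneg x)]; exact hC x
  -- The limit integrand: radius `1`, first point at the origin, all weights evaluated at the same
  -- `c`.
  refine ⟨∫ y : Fin m → EuclideanSpace ℝ (Fin d),
    {y | (RandomCech.skeletonGraph (RandomCech.cechComplex 1 y)).Connected ∧
      RandomCech.betti (RandomCech.cechComplex 1 y) k = j}.indicator 1 (RandomCech.originCons y) *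
        ∫ c, ∏ b, RandomCech.leftMostWeight A f (RandomCech.originCons y) b c,
    fun r hr hr0 Ω _ P _ X hX hlaw => ?_⟩
  have hXm : AEMeasurable (fun ω a => X a ω) P := aemeasurable_pi_lambda _ fun a =>
    (hlaw a).aemeasurable
  have hg : ∀ n, Measurable (RandomCech.g k j A (r n) :
      (Fin (m + 1) → EuclideanSpace ℝ (Fin d)) → ℝ) := fun n =>
    RandomCech.measurable_g k j hA.measurableSet
  have hmap : P.map (fun ω a => X a ω) = (volume : Measure
      (Fin (m + 1) → EuclideanSpace ℝ (Fin d))).withDensity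
        fun x => ENNReal.ofReal (∏ a, f (x a)) := by
    rw [(iIndepFun_iff_map_fun_eq_pi_map fun a => (hlaw a).aemeasurable).1 hX,
      ← RandomCech.pi_withDensity_ofReal hf_nonneg hfi]
    congr 1
    ext1 a
    exact (hlaw a).map_eq
  have hE : ∀ n, ∫ ω, RandomCech.g k j A (r n) (fun a => X a ω) ∂P =
      ∫ x, RandomCech.weightedIndicator (fun K => (RandomCech.skeletonGraph K).Connected ∧
        RandomCech.betti K k = j) A f (r n) x := fun n => by
    rw [← integral_map hXm (hg n).aestronglyMeasurable, hmap,
      integral_withDensity_eq_integral_toReal_smul (by fun_prop)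
        (Eventually.of_forall fun _ => ENNReal.ofReal_lt_top)]
    refine integral_congr_ae (Eventually.of_forall fun x => ?_)
    simp only [smul_eq_mul]
    rw [ENNReal.toReal_ofReal (Finset.prod_nonneg fun a _ => hf_nonneg _),
      RandomCech.prod_mul_g]
  refine ⟨fun n => ?_, ?_⟩
  · refine Integrable.of_bound ((hg n).comp_aemeasurable hXm).aestronglyMeasurable 1
      (Eventually.of_forall fun ω => ?_)
    unfold RandomCech.g
    split_ifs <;> simp
  · have hz : ∀ n, r n ^ (-((d : ℤ) * (((m + 1 : ℕ) : ℤ) - 1))) = (r n ^ (d * m))⁻¹ := fun n => by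
      rw [zpow_neg, Nat.cast_succ, add_sub_cancel_right, ← Nat.cast_mul, zpow_natCast]
    simp_rw [hE, hz]
    exact RandomCech.tendsto_integral_weightedIndicator hA.measurableSet hf_meas hfi
      (fun K hK => hK.1) hC' hr hr0
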